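/- Let $f:\mathbb{C}[x,y]\to\mathbb{C}[x,y]$ be a $\mathbb{C}$-algebra endomorphism, put $p=f(x)$ and $q=f(y)$, and assume that the Jacobian determinant $\mathrm{Jac}(p,q)=\frac{\partial p}{\partial x}\frac{\partial q}{\partial y}-\frac{\partial p}{\partial y}\frac{\partial q}{\partial x}$ is a nonzero constant. Then there exist $u\in\mathbb{C}[p,q,x]\setminus\{0\}$ and $v\in\mathbb{C}[p,q]\setminus\{0\}$ such that $y=u/v$ in $\mathbb{C}(x,y)$. Moreover, for every such pair $(u,v)$: if the group of invertible elements of the subring $\mathbb{C}[p,q,x][1/v]$ of $\mathbb{C}(x,y)$ is contained in $\mathbb{C}(p,q)\setminus\{0\}$, then $f$ is an automorphism of $\mathbb{C}[x,y]$. -/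

import Mathlib

/-- The polynomial ring `ℂ[x, y]`, with `x = X 0` and `y = X 1`. -/
abbrev PolyXY : Type := MvPolynomial (Fin 2) ℂ

/-- The field of rational functions `ℂ(x, y)`. -/
abbrev RatXY : Type := FractionRing PolyXY

/-- The Jacobian determinant `Jac(p, q) = p_x q_y - p_y q_x`. -/
noncomputable def jac (p q : PolyXY) : PolyXY :=
  Matrix.det !![MvPolynomial.pderiv 0 p, MvPolynomial.pderiv 1 p;
    MvPolynomial.pderiv 0 q, MvPolynomial.pderiv 1 q]

/-- `y = u / v` in `ℂ(x, y)`, with `u ∈ ℂ[p, q, x] ∖ 0` and `v ∈ ℂ[p, q] ∖ 0`. -/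
structure IsFractionForY (p q u v : PolyXY) : Prop where
  u_mem : u ∈ Algebra.adjoin ℂ {p, q, MvPolynomial.X 0}
  u_ne_zero : u ≠ 0
  v_mem : v ∈ Algebra.adjoin ℂ {p, q}
  v_ne_zero : v ≠ 0
  y_eq : algebraMap PolyXY RatXY (MvPolynomial.X 1) =
    algebraMap PolyXY RatXY u / algebraMap PolyXY RatXY v

/-- The ring `ℂ[p, q, x][1 / v]`, as a subalgebra of `ℂ(x, y)`. -/
noncomputable def pqxInv (p q v : PolyXY) : Subalgebra ℂ RatXY :=
  Algebra.adjoin ℂ {algebraMap PolyXY RatXY p, algebraMap PolyXY RatXY q,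
    algebraMap PolyXY RatXY (MvPolynomial.X 0), (algebraMap PolyXY RatXY v)⁻¹}

/-- The field `ℂ(p, q)`, as a subfield of `ℂ(x, y)`. -/
noncomputable def fieldPQ (p q : PolyXY) : IntermediateField ℂ RatXY :=
  IntermediateField.adjoin ℂ {algebraMap PolyXY RatXY p, algebraMap PolyXY RatXY q}

/-! Existence of $(u,v)$ is Formanek's $\mathbb{C}(p,q,x)=\mathbb{C}(x,y)$. Over
$L=\mathbb{C}(p,q,x)$ the minimal polynomial of $y$ divides $p(x,T)-p(x,y)$ and $q(x,T)-q(x,y)$. The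
Jacobian condition makes $p_y,q_y$ coprime, which forces these two polynomials to share only the
root $T=y$, so $y\in L$ (`X_mem_range_of_isCoprime_derivative`). The denominator is algebraic over
$\mathbb{C}[p,q]$ and can be moved into it.

For the second claim, $B=\mathbb{C}[p,q]$ is factorial because $f$ is injective, so the polynomials
over $B$ vanishing at $x$ are the multiples of a single $g$. Since the Jacobian is a nonzero
constant, $g'(x)$ divides a power of $v$ (`aeval_derivative_dvd_pow`), hence is a unit of
$\mathbb{C}[p,q,x][1/v]$. The hypothesis on units puts $g'(x)$ in $\mathbb{C}(p,q)$; as $\deg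
g'<\deg g$, this forces $\deg g=1$, so $x\in\mathbb{C}(p,q)$. Keller's birational case
(`mem_range_of_mul_eq`) then gives $x\in B$, and, applied to $y=u/v$, also $y\in B$. -/

/-! ### Gauss's lemma and vanishing ideals over a factorial domain -/

section UniquelyFactorial

open Polynomial

variable {R : Type*} [CommRing R] [IsDomain R] [UniqueFactorizationMonoid R]

/-- A nonzero polynomial over the fraction field is a scalar multiple of a primitive polynomial. -/
theorem exists_isPrimitive_map_associated (z : (FractionRing R)[X]) (hz : z ≠ 0) :
    ∃ d : R[X], d.IsPrimitive ∧ Associated (d.map (algebraMap R (FractionRing R))) z := by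
  classical
  let : NormalizedGCDMonoid R := Classical.choice inferInstance
  obtain ⟨b, hb, h⟩ := IsLocalization.integerNormalization_spec (nonZeroDivisors R) z
  set w := IsLocalization.integerNormalization (nonZeroDivisors R) z
  have hw : w ≠ 0 := by rwa [Ne, IsFractionRing.integerNormalization_eq_zero_iff]
  have hc : algebraMap R (FractionRing R) w.content ≠ 0 := by
    simpa [content_eq_zero_iff] using hw
  have hb' : algebraMap R (FractionRing R) b ≠ 0 := by
    simpa using nonZeroDivisors.ne_zero hb
  refine ⟨w.primPart, isPrimitive_primPart w, ?_⟩
  have e : C (algebraMap R (FractionRing R) w.content) *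
      w.primPart.map (algebraMap R (FractionRing R)) = C (algebraMap R (FractionRing R) b) * z := by
    rw [← map_C, ← Polynomial.map_mul, ← eq_C_content_mul_primPart, h, algebra_compatible_smul
      (FractionRing R) b z, smul_eq_C_mul]
  have h1 := associated_unit_mul_left (w.primPart.map (algebraMap R (FractionRing R))) _
    (isUnit_C.2 hc.isUnit)
  have h2 := associated_unit_mul_left z _ (isUnit_C.2 hb'.isUnit)
  rw [e] at h1
  exact h1.symm.trans h2

/-- Gauss: if all common divisors are constants, the ideal generated contains a nonzero constant. -/
theorem exists_mul_add_mul_eq_C {a b : R[X]} (h : ∀ d, d ∣ a → d ∣ b → d.natDegree = 0) :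
    ∃ s t : R[X], ∃ r : R, r ≠ 0 ∧ s * a + t * b = C r := by
  have hcop : IsCoprime (a.map (algebraMap R (FractionRing R)))
      (b.map (algebraMap R (FractionRing R))) := by
    refine isCoprime_of_irreducible_dvd ?_ fun z hz hza hzb ↦ ?_
    · rintro ⟨ha, hb⟩
      rw [Polynomial.map_eq_zero_iff (IsFractionRing.injective R _)] at ha hb
      simpa using h X (by simp [ha]) (by simp [hb])
    · obtain ⟨d, hd, hdz⟩ := exists_isPrimitive_map_associated z hz.ne_zero
      have h0 := h d (hd.dvd_of_fraction_map_dvd_fraction_map (hdz.dvd.trans hza))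
        (hd.dvd_of_fraction_map_dvd_fraction_map (hdz.dvd.trans hzb))
      apply hz.natDegree_pos.ne'
      rw [← natDegree_eq_of_degree_eq (degree_eq_degree_of_associated hdz),
        natDegree_map_eq_of_injective (IsFractionRing.injective R _), h0]
  obtain ⟨s, t, hst⟩ := hcop
  obtain ⟨b₁, hb₁, h₁⟩ := IsLocalization.integerNormalization_spec (nonZeroDivisors R) s
  obtain ⟨b₂, hb₂, h₂⟩ := IsLocalization.integerNormalization_spec (nonZeroDivisors R) t
  set s' := IsLocalization.integerNormalization (nonZeroDivisors R) s
  set t' := IsLocalization.integerNormalization (nonZeroDivisors R) t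
  refine ⟨C b₂ * s', C b₁ * t', b₁ * b₂, mul_ne_zero (nonZeroDivisors.ne_zero hb₁)
    (nonZeroDivisors.ne_zero hb₂), ?_⟩
  apply Polynomial.map_injective _ (IsFractionRing.injective R (FractionRing R))
  rw [algebra_compatible_smul (FractionRing R), smul_eq_C_mul] at h₁ h₂
  simp only [Polynomial.map_add, Polynomial.map_mul, map_C, h₁, h₂, map_mul]
  linear_combination (C (algebraMap R (FractionRing R) b₁) *
    C (algebraMap R (FractionRing R) b₂)) * hst

/-- Over a factorial domain, the polynomials vanishing at an algebraic element form a
principal ideal. -/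
theorem exists_generator_of_isAlgebraic {A : Type*} [CommRing A] [IsDomain A] [Algebra R A]
    [FaithfulSMul R A] {x : A} (hx : IsAlgebraic R x) :
    ∃ g : R[X], g ≠ 0 ∧ aeval x g = 0 ∧ ∀ H : R[X], aeval x H = 0 → g ∣ H := by
  let := FractionRing.liftAlgebra R (FractionRing A)
  have := FractionRing.isScalarTower_liftAlgebra R (FractionRing A)
  let ξ := algebraMap A (FractionRing A) x
  have key (H : R[X]) : aeval ξ (H.map (algebraMap R (FractionRing R))) = 0 ↔ aeval x H = 0 := by
    rw [aeval_map_algebraMap, aeval_algebraMap_apply]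
    simp
  obtain ⟨H₀, hH₀, hH₀'⟩ := hx
  have hne : minpoly (FractionRing R) ξ ≠ 0 := by
    intro h0
    have := minpoly.dvd (FractionRing R) ξ ((key H₀).2 hH₀')
    rw [h0, zero_dvd_iff, Polynomial.map_eq_zero_iff (IsFractionRing.injective R _)] at this
    exact hH₀ this
  obtain ⟨g, hg, hgm⟩ := exists_isPrimitive_map_associated _ hne
  refine ⟨g, hg.ne_zero, (key g).1 ?_, fun H hH ↦ ?_⟩
  · obtain ⟨c, hc⟩ := hgm.symm.dvd
    rw [hc, map_mul, minpoly.aeval, zero_mul]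
  · exact hg.dvd_of_fraction_map_dvd_fraction_map
      (hgm.dvd.trans (minpoly.dvd _ _ ((key H).2 hH)))

omit [UniqueFactorizationMonoid R] in
/-- If the derivative of the generator of the vanishing ideal of `x` takes a value in the
fraction field of `R` at `x`, then `x` itself is in that fraction field. -/
theorem exists_mul_eq_of_derivative_mem {A : Type*} [CommRing A] [IsDomain A] [Algebra R A]
    [FaithfulSMul R A] [CharZero R] {x : A} {g : R[X]} (hg0 : g ≠ 0) (hgx : aeval x g = 0)
    (hg : ∀ H : R[X], aeval x H = 0 → g ∣ H) {b₁ b₂ : R} (hb₂ : b₂ ≠ 0)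
    (h : algebraMap R A b₂ * aeval x (derivative g) = algebraMap R A b₁) :
    ∃ a b : R, b ≠ 0 ∧ algebraMap R A b * x = algebraMap R A a := by
  have hdeg : g.natDegree ≠ 0 := by
    intro h0
    rw [natDegree_eq_zero] at h0
    obtain ⟨r, rfl⟩ := h0
    simp at hgx hg0
    exact hg0 hgx
  -- This polynomial vanishes at `x` but has smaller degree than `g`; so `g'` is constant, and
  -- characteristic zero gives degree one.
  have hz : C b₂ * derivative g - C b₁ = 0 := by
    apply eq_zero_of_dvd_of_natDegree_lt (hg _ (by simp [h]))
    rw [natDegree_sub_C, natDegree_C_mul hb₂]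
    exact natDegree_derivative_lt hdeg
  have h1 : g.natDegree - 1 = 0 := by
    rw [← natDegree_derivative, ← natDegree_C_mul hb₂, sub_eq_zero.1 hz, natDegree_C]
  obtain ⟨b, hb, a, rfl⟩ := natDegree_eq_one.1 (show g.natDegree = 1 by omega)
  exact ⟨-a, b, hb, by simpa [add_eq_zero_iff_eq_neg] using hgx⟩

end UniquelyFactorial

/-! ### Common divisors of difference quotients -/

section Difference

open Polynomial

variable {R : Type*} [CommRing R] [IsDomain R] [CharZero R]

/-- The difference `p(y + h) - p(y)`, as a polynomial in `y` over `R[h]`: a divisor times `h`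
has leading coefficient in `R`, and specializes at `h = 0` to a divisor of `p'`. -/
theorem dvd_of_C_X_mul_dvd_difference {p : R[X]} {n : R[X][X]}
    (h : C X * n ∣ aeval (X + C X : R[X][X]) p - aeval (X : R[X][X]) p) :
    n.map (evalRingHom 0) ∣ derivative p ∧
      (derivative p ≠ 0 → ∃ r : R, r ≠ 0 ∧ n.leadingCoeff = C r) := by
  obtain ⟨m, hm⟩ := h
  constructor
  · obtain ⟨k, hk⟩ := binomExpansion (p.map (algebraMap R R[X][X])) X (C X)
    simp only [derivative_map, eval_map_algebraMap] at hk
    -- Taylor expansion to second order, divided by $h$; setting $h=0$ leaves $p'$.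
    have e : n * m = aeval (X : R[X][X]) (derivative p) + k * C X := by
      apply mul_left_cancel₀ (C_ne_zero.2 X_ne_zero : (C X : R[X][X]) ≠ 0)
      linear_combination - hm + hk
    refine ⟨m.map (evalRingHom 0), ?_⟩
    rw [← Polynomial.map_mul, e, aeval_X_left_eq_map, Polynomial.map_add, Polynomial.map_mul,
      Polynomial.map_map]
    have hid : (evalRingHom (0 : R)).comp C = RingHom.id R := by
      ext; simp
    simp [hid]
  · intro hp
    obtain ⟨k, hk⟩ := Nat.exists_eq_succ_of_ne_zero
      (show p.natDegree ≠ 0 from fun h ↦ hp (derivative_of_natDegree_zero h))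
    set f : R[X][X] := p.map C with hf
    have hfd : f.natDegree = k + 1 := by rw [hf, natDegree_map_eq_of_injective C_injective, hk]
    have hD : aeval (X + C X : R[X][X]) p - aeval (X : R[X][X]) p = taylor X f - f := by
      rw [taylor_apply, comp, hf, eval₂_map, aeval_X_left_eq_map]
      rfl
    have hle : (taylor X f - f).natDegree ≤ k := by
      refine natDegree_le_iff_coeff_eq_zero.2 fun N hN ↦ ?_
      rcases (Nat.succ_le_of_lt hN).eq_or_lt with rfl | hN
      · rw [coeff_sub, Nat.succ_eq_add_one, ← hfd, coeff_taylor_natDegree, leadingCoeff, sub_self]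
      · rw [coeff_sub, coeff_eq_zero_of_natDegree_lt (by rw [natDegree_taylor]; omega),
          coeff_eq_zero_of_natDegree_lt (by omega), sub_self]
    -- With $\deg p=k+1$, the top terms in $y$ cancel and the next coefficient is
    -- $(k+1)\,\mathrm{lc}(p)\,h$. Cancelling $h$ below leaves a nonzero element of `R`, whose
    -- factors are constant in $h$.
    have hc : (taylor X f - f).coeff k = C ((k + 1) * p.leadingCoeff) * X := by
      have h1 : (hasseDeriv k f).natDegree ≤ 1 := (natDegree_hasseDeriv_le f k).trans (by omega)
      rw [coeff_sub, taylor_coeff, eq_X_add_C_of_natDegree_le_one h1]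
      simp [hasseDeriv_coeff, add_comm 1 k, hf, leadingCoeff, hk]
    have hr : ((k : R) + 1) * p.leadingCoeff ≠ 0 := by
      refine mul_ne_zero (by exact_mod_cast k.succ_ne_zero) (leadingCoeff_ne_zero.2 ?_)
      rintro rfl
      simp at hp
    have hlc : (taylor X f - f).leadingCoeff = C ((k + 1) * p.leadingCoeff) * X := by
      rw [← hc, leadingCoeff]
      congr 1
      refine le_antisymm hle (le_natDegree_of_ne_zero ?_)
      rw [hc]
      exact mul_ne_zero (C_ne_zero.2 hr) X_ne_zero
    rw [← hD, hm, leadingCoeff_mul, leadingCoeff_mul, leadingCoeff_C] at hlc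
    have e : n.leadingCoeff * m.leadingCoeff = C ((k + 1) * p.leadingCoeff) := by
      apply mul_left_cancel₀ (X_ne_zero (R := R))
      linear_combination hlc
    have hne : n.leadingCoeff * m.leadingCoeff ≠ 0 := e ▸ C_ne_zero.2 hr
    have hdeg : n.leadingCoeff.natDegree + m.leadingCoeff.natDegree = 0 := by
      rw [← natDegree_mul (left_ne_zero_of_mul hne) (right_ne_zero_of_mul hne), e, natDegree_C]
    have hn := eq_C_of_natDegree_eq_zero (Nat.add_eq_zero_iff.1 hdeg).1
    refine ⟨n.leadingCoeff.coeff 0, fun h0 ↦ left_ne_zero_of_mul hne ?_, hn⟩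
    rw [hn, h0, C_0]

/-- At $h=0$ a common divisor of the difference quotients divides both $p'$ and $q'$, so it becomes
a unit. Its leading coefficient in $y$ does not involve $h$, so no degree is lost in this
specialization. -/
theorem natDegree_eq_zero_of_dvd_difference {p q : R[X]} (hpq : IsCoprime (derivative p)
    (derivative q)) {n : R[X][X]}
    (hp : C X * n ∣ aeval (X + C X : R[X][X]) p - aeval (X : R[X][X]) p)
    (hq : C X * n ∣ aeval (X + C X : R[X][X]) q - aeval (X : R[X][X]) q) :
    ∃ r : R, n = C (C r) := by
  obtain ⟨hp₁, hp₂⟩ := dvd_of_C_X_mul_dvd_difference hp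
  obtain ⟨hq₁, hq₂⟩ := dvd_of_C_X_mul_dvd_difference hq
  obtain ⟨r, hr, hn⟩ : ∃ r : R, r ≠ 0 ∧ n.leadingCoeff = C r := by
    by_cases h : derivative p = 0
    · exact hq₂ fun h' ↦ not_isCoprime_zero_zero (by simpa [h, h'] using hpq)
    · exact hp₂ h
  have hu := hpq.isUnit_of_dvd' hp₁ hq₁
  have hd : n.natDegree = 0 := by
    rw [← natDegree_map_of_leadingCoeff_ne_zero (evalRingHom 0) (by simpa [hn] using hr)]
    exact natDegree_eq_zero_of_isUnit hu
  refine ⟨r, ?_⟩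
  rw [← hn, leadingCoeff, hd]
  exact eq_C_of_natDegree_eq_zero hd

end Difference

/-! ### Recovering the variable from two polynomials with coprime derivatives -/

section PolynomialSubfield

open Polynomial

/-- If `p'` and `q'` are coprime, then a field containing the coefficients, `p` and `q`
contains the variable. -/
theorem X_mem_range_of_isCoprime_derivative {R L F : Type*} [CommRing R] [IsDomain R]
    [UniqueFactorizationMonoid R] [CharZero R] [Field L] [Field F] [Algebra L F]
    {ι : R[X] →+* F} (hι : Function.Injective ι)
    (hR : ∀ r, ι (C r) ∈ (algebraMap L F).range) {p q : R[X]}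
    (hpq : IsCoprime (derivative p) (derivative q))
    (hp : ι p ∈ (algebraMap L F).range) (hq : ι q ∈ (algebraMap L F).range) :
    ι X ∈ (algebraMap L F).range := by
  -- $f(y+h)-f(y)$ with $h$ as the outer variable, as elimination of $h$ requires; `Bivariate.swap`
  -- makes $y$ the outer variable for the divisibility lemmas above.
  let E (f : R[X]) : R[X][X] := aeval (X + C X : R[X][X]) f - aeval (C X : R[X][X]) f
  have hE (f : R[X]) : X ∣ E f := by
    rw [X_dvd_iff, coeff_zero_eq_eval_zero]
    have h (g : R[X][X]) : eval 0 (aeval g f) = aeval (eval 0 g) f := by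
      have := (aeval_algHom_apply ((aeval (0 : R[X])).restrictScalars R) g f).symm
      simpa [coe_aeval_eq_eval] using this
    simp [E, h]
  have hswap (f : R[X]) : Bivariate.swap (E f) =
      aeval (X + C X : R[X][X]) f - aeval (X : R[X][X]) f := by
    rw [map_sub, ← aeval_algHom_apply, ← aeval_algHom_apply, map_add, Bivariate.swap_X,
      Bivariate.swap_Y, add_comm]
  obtain ⟨p₁, hp₁⟩ := hE p
  obtain ⟨q₁, hq₁⟩ := hE q
  obtain ⟨s, t, r, hr, hst⟩ := exists_mul_add_mul_eq_C (a := p₁) (b := q₁) fun d hdp hdq ↦ by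
    have h (f₁ : R[X][X]) (g : R[X]) (hg : E g = X * f₁) (hd : d ∣ f₁) :
        C X * Bivariate.swap d ∣ aeval (X + C X : R[X][X]) g - aeval (X : R[X][X]) g := by
      obtain ⟨w, rfl⟩ := hd
      exact ⟨Bivariate.swap w, by rw [← hswap, hg, map_mul, map_mul, Bivariate.swap_Y, mul_assoc]⟩
    obtain ⟨r, hr⟩ := natDegree_eq_zero_of_dvd_difference hpq
      (h _ p hp₁ hdp) (h _ q hq₁ hdq)
    have hd : d = C (C r) := by
      rw [← Bivariate.swap_swap_apply d, hr, Bivariate.swap_C_C]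
    rw [hd, natDegree_C]
  -- The polynomial $f(T)-f(y)$ has coefficients in `L` and root $y$; the Taylor shift substitutes
  -- $T=y+h$.
  have hmin (f : R[X]) (hf : ι f ∈ (algebraMap L F).range) :
      taylor (ι X) ((minpoly L (ι X)).map (algebraMap L F)) ∣ (E f).map ι := by
    obtain ⟨c, hc⟩ := hf
    obtain ⟨g₀, hg₀⟩ := (mem_lifts (f := algebraMap L F) (f.map (ι.comp C))).1 <| by
      rw [lifts_iff_coeff_lifts]
      intro n
      simpa using hR (f.coeff n)
    let g := g₀ - C c
    have hg : g.map (algebraMap L F) = f.map (ι.comp C) - C (ι f) := by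
      rw [Polynomial.map_sub, hg₀, map_C, hc]
    have hev : eval (ι X) (f.map (ι.comp C)) = ι f := by
      rw [eval_map, ← hom_eval₂, eval₂_C_X]
    have hroot : aeval (ι X) g = 0 := by
      rw [aeval_def, ← eval_map, hg, eval_sub, eval_C, hev, sub_self]
    obtain ⟨w, hw⟩ := minpoly.dvd L _ hroot
    have h : taylor (ι X) ((minpoly L (ι X)).map (algebraMap L F)) ∣
        taylor (ι X) (g.map (algebraMap L F)) :=
      ⟨taylor (ι X) (w.map (algebraMap L F)), by rw [hw, Polynomial.map_mul, taylor_mul]⟩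
    rw [hg] at h
    refine h.trans (dvd_of_eq ?_)
    have h₁ : (aeval (X + C X : R[X][X]) f).map ι = (f.map (ι.comp C)).comp (X + C (ι X)) := by
      rw [← coe_mapRingHom, aeval_def, hom_eval₂, comp, eval₂_map]
      have hC : (mapRingHom ι).comp (algebraMap R R[X][X]) = C.comp (ι.comp C) :=
        RingHom.ext fun a ↦ by
          change Polynomial.map ι (C (C a)) = _
          simp
      rw [hC]
      simp
    have h₂ : (aeval (C X : R[X][X]) f).map ι = C (ι f) := by
      rw [← algebraMap_eq, aeval_algebraMap_apply, aeval_X_left_apply, algebraMap_eq, map_C]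
    simp only [E, Polynomial.map_sub, h₁, h₂, taylor_apply, sub_comp, C_comp]
  -- The shifted minimal polynomial divides $r h$ with $r\neq0$ free of $h$, so its degree is at
  -- most one.
  have hX : taylor (ι X) ((minpoly L (ι X)).map (algebraMap L F)) ∣ C (ι r) * X := by
    have hsum : X * (s * p₁ + t * q₁) = s * E p + t * E q := by rw [hp₁, hq₁]; ring
    have hmap := congrArg (Polynomial.map ι) hsum
    rw [hst, Polynomial.map_mul, map_X, map_C, Polynomial.map_add, Polynomial.map_mul,
      Polynomial.map_mul, mul_comm] at hmap
    rw [hmap]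
    exact dvd_add ((hmin p hp).mul_left _) ((hmin q hq).mul_left _)
  have hr' : ι r ≠ 0 := (map_ne_zero_iff ι hι).2 hr
  have hdeg := natDegree_le_of_dvd hX (mul_ne_zero (C_ne_zero.2 hr') X_ne_zero)
  rw [natDegree_taylor, natDegree_map, natDegree_C_mul_X _ hr'] at hdeg
  rw [← minpoly.natDegree_eq_one_iff]
  refine le_antisymm hdeg (minpoly.natDegree_pos ?_)
  by_contra hint
  rw [minpoly.eq_zero hint, Polynomial.map_zero, map_zero, zero_dvd_iff] at hX
  exact mul_ne_zero (C_ne_zero.2 hr') X_ne_zero hX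

end PolynomialSubfield

/-! ### Injectivity, algebraicity and Keller's birational case -/

section Keller

open MvPolynomial

theorem jac_eq (p q : PolyXY) :
    jac p q = pderiv 0 p * pderiv 1 q - pderiv 1 p * pderiv 0 q := by
  simp [jac, Matrix.det_fin_two]

theorem pderiv_algHom_apply (f : PolyXY →ₐ[ℂ] PolyXY) (i : Fin 2) (h : PolyXY) :
    pderiv i (f h) = f (pderiv 0 h) * pderiv i (f (X 0)) + f (pderiv 1 h) * pderiv i (f (X 1)) := by
  induction h using MvPolynomial.induction_on with
  | C a => simp [← algebraMap_eq]
  | add a b ha hb => simp only [map_add, ha, hb]; ring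
  | mul_X a j ha =>
    simp only [map_mul, Derivation.leibniz, ha, smul_eq_mul, map_add]
    fin_cases j <;> simp [pderiv_X] <;> ring

theorem pderiv_eq_zero_or_totalDegree_lt (i : Fin 2) (h : PolyXY) :
    pderiv i h = 0 ∨ (pderiv i h).totalDegree < h.totalDegree := by
  by_contra! ⟨h0, hlt⟩
  obtain ⟨m, hm, hdeg⟩ := Finset.exists_mem_eq_sup _ (support_nonempty.2 h0) 
    fun s ↦ s.sum fun _ e ↦ e
  rw [mem_support_iff, coeff_pderiv] at hm
  have := le_totalDegree (mem_support_iff.2 (left_ne_zero_of_mul hm))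
  rw [Finsupp.sum_add_index' (by simp) (by simp), Finsupp.sum_single_index rfl] at this
  have hd : (pderiv i h).totalDegree = m.sum fun _ e ↦ e := hdeg
  omega

theorem eq_C_of_pderiv_eq_zero {h : PolyXY} (h0 : ∀ i, pderiv i h = 0) : ∃ a, h = C a := by
  refine ⟨coeff 0 h, ?_⟩
  ext m
  rw [coeff_C]
  split_ifs with hm
  · rw [← hm]
  · obtain ⟨i, hi⟩ := Finsupp.ne_iff.1 (Ne.symm hm)
    have := congrArg (coeff (m - Finsupp.single i 1)) (h0 i)
    rw [coeff_pderiv, tsub_add_cancel_of_le (by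
      simpa [Finsupp.single_le_iff, Nat.one_le_iff_ne_zero] using hi), coeff_zero] at this
    exact (mul_eq_zero.1 this).resolve_right (Nat.cast_add_one_ne_zero _)

variable {f : PolyXY →ₐ[ℂ] PolyXY} {c : ℂ}

/-- If $f(h)=0$, the chain rule and Cramer's rule give $f(h_x)=f(h_y)=0$. By induction on total
degree both partial derivatives vanish, so $h$ is a constant, which $f$ fixes. -/
theorem injective_of_jac (hc : c ≠ 0) (hJ : jac (f (X 0)) (f (X 1)) = C c) :
    Function.Injective f := by
  rw [injective_iff_map_eq_zero]
  intro h
  induction hn : h.totalDegree using Nat.strong_induction_on generalizing h with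
  | _ n ih =>
    intro hh
    have e (i) := pderiv_algHom_apply f i h
    simp only [hh, map_zero] at e
    have hc' : (C c : PolyXY) ≠ 0 := C_ne_zero.2 hc
    rw [jac_eq] at hJ
    have e₀ : f (pderiv 0 h) = 0 := by
      apply mul_right_cancel₀ hc'
      rw [← hJ]
      linear_combination pderiv 0 (f (X 1)) * e 1 - pderiv 1 (f (X 1)) * e 0
    have e₁ : f (pderiv 1 h) = 0 := by
      apply mul_right_cancel₀ hc'
      rw [← hJ]
      linear_combination pderiv 1 (f (X 0)) * e 0 - pderiv 0 (f (X 0)) * e 1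
    have hz (i) (hi : f (pderiv i h) = 0) : pderiv i h = 0 := by
      rcases pderiv_eq_zero_or_totalDegree_lt i h with h0 | hlt
      · exact h0
      · exact ih _ (hn ▸ hlt) _ rfl hi
    obtain ⟨a, rfl⟩ := eq_C_of_pderiv_eq_zero (h := h) fun i ↦ by
      fin_cases i
      · exact hz 0 e₀
      · exact hz 1 e₁
    simpa [← algebraMap_eq] using hh

theorem range_eq_adjoin : f.range = Algebra.adjoin ℂ {f (X 0), f (X 1)} := by
  rw [← Algebra.map_top, ← adjoin_range_X, AlgHom.map_adjoin, ← Set.range_comp]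
  congr 1
  ext z
  simp [Fin.exists_fin_two, eq_comm]

/-- The images of the variables are two algebraically independent elements in transcendence degree
two, hence a transcendence basis. -/
theorem isAlgebraic_of_injective (hf : Function.Injective f) :
    Algebra.IsAlgebraic (Algebra.adjoin ℂ {f (X 0), f (X 1)}) PolyXY := by
  have hind : AlgebraicIndependent ℂ (f ∘ (X : Fin 2 → PolyXY)) :=
    (algebraicIndependent_X (Fin 2) ℂ).map' hf
  have hb : IsTranscendenceBasis ℂ (f ∘ (X : Fin 2 → PolyXY)) := by
    apply hind.isTranscendenceBasis_of_trdeg_le_of_finite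
    rw [MvPolynomial.trdeg_of_isDomain, Cardinal.lift_id]
  have hr : Set.range (f ∘ (X : Fin 2 → PolyXY)) = {f (X 0), f (X 1)} := by
    ext z
    simp [Fin.exists_fin_two, eq_comm]
  have := hb.isAlgebraic
  rwa [hr] at this

/-- A prime ideal containing coprime elements contains `X i - α` for each `i`. -/
theorem exists_X_sub_C_mem {P : Ideal PolyXY} [hP : P.IsPrime] {w a : PolyXY} (hw : Prime w)
    (hwP : w ∈ P) (haP : a ∈ P) (hwa : ¬ w ∣ a) (i : Fin 2) : ∃ α, X i - C α ∈ P := by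
  have hmax : P.IsMaximal := by
    obtain ⟨M, hM, hPM⟩ := Ideal.exists_le_maximal P hP.ne_top
    by_contra hne
    have hlt : P < M := lt_of_le_of_ne hPM fun h ↦ hne (h ▸ hM)
    have hwp : (Ideal.span {w}).IsPrime := (Ideal.span_singleton_prime hw.ne_zero).2 hw
    -- If `P` were not maximal, $0\subset(w)\subset P\subset M$ would be a chain of length 3 in a
    -- ring of Krull dimension 2.
    let s : LTSeries (PrimeSpectrum PolyXY) :=
      { length := 3
        toFun := ![⟨⊥, Ideal.isPrime_bot⟩, ⟨Ideal.span {w}, hwp⟩, ⟨P, hP⟩, ⟨M, hM.isPrime⟩]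
        step := by
          intro j
          fin_cases j
          · change (⊥ : Ideal PolyXY) < Ideal.span {w}
            rw [bot_lt_iff_ne_bot, Ne, Ideal.span_singleton_eq_bot]
            exact hw.ne_zero
          · change Ideal.span {w} < P
            refine lt_of_le_of_ne ((Ideal.span_singleton_le_iff_mem _).2 hwP) fun h ↦ hwa ?_
            rwa [← Ideal.mem_span_singleton, h]
          · exact hlt }
    have h := Order.LTSeries.length_le_krullDim s
    rw [← ringKrullDim, MvPolynomial.ringKrullDim_of_isNoetherianRing] at h
    norm_num [s] at h
  obtain ⟨z, rfl⟩ := isMaximal_iff_eq_vanishingIdeal_singleton.1 hmax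
  exact ⟨z i, by simp⟩

/-- Keller: an element of the fraction field of the image is in the image. -/
theorem mem_range_of_mul_eq (hc : c ≠ 0) (hJ : jac (f (X 0)) (f (X 1)) = C c)
    {a b z : PolyXY} (hb : b ≠ 0) (h : f b * z = f a) : z ∈ f.range := by
  have hf := injective_of_jac hc hJ
  obtain ⟨a', b', d, hrel, rfl, rfl⟩ := UniqueFactorizationMonoid.exists_reduced_factors' a b hb
  have hd : f d ≠ 0 := (map_ne_zero_iff f hf).2 (left_ne_zero_of_mul hb)
  replace h : f b' * z = f a' := mul_left_cancel₀ hd (by simpa [mul_assoc] using h)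
  by_cases hu : IsUnit b'
  · obtain ⟨u, rfl⟩ := hu
    refine ⟨↑u⁻¹ * a', ?_⟩
    change f (↑u⁻¹ * a') = z
    rw [map_mul, ← h, ← mul_assoc, ← map_mul, Units.inv_mul, map_one, one_mul]
  exfalso
  obtain ⟨w, hw, hwb⟩ := WfDvdMonoid.exists_irreducible_factor hu (right_ne_zero_of_mul hb)
  have hwp : Prime w := hw.prime
  have hfw : ¬ IsUnit (f w) := by
    intro hun
    rw [MvPolynomial.isUnit_iff_eq_C_of_isReduced] at hun
    obtain ⟨r, hr, hrw⟩ := hun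
    apply hw.not_isUnit
    have : w = C r := hf (by rw [hrw, ← algebraMap_eq, AlgHom.commutes])
    rw [this]
    exact hr.map C
  obtain ⟨π, hπ, hπw⟩ := WfDvdMonoid.exists_irreducible_factor hfw
    ((map_ne_zero_iff f hf).2 hw.ne_zero)
  have hπp := hπ.prime
  -- Geometrically, the curve $\pi=0$ maps into $a'=w=0$. As $w\nmid a'$, it is contracted to a
  -- single point $\alpha$.
  let P := (Ideal.span {π}).comap f
  have hπI : (Ideal.span {π}).IsPrime := (Ideal.span_singleton_prime hπ.ne_zero).2 hπp
  have hP : P.IsPrime := Ideal.comap_isPrime _ _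
  have hmem (t) : t ∈ P ↔ π ∣ f t := by
    rw [Ideal.mem_comap, Ideal.mem_span_singleton]
  have hwP : w ∈ P := (hmem w).2 hπw
  have haP : a' ∈ P := by
    rw [hmem, ← h]
    exact (hπw.trans (map_dvd f hwb)).mul_right _
  have hwa : ¬ w ∣ a' := fun hwa ↦ hw.not_isUnit (hrel hwa hwb)
  have hX := exists_X_sub_C_mem hwp hwP haP hwa
  choose α hα using hX
  simp only [hmem, map_sub] at hα
  have hα' (i) : ∃ s, f (X i) = π * s + C (α i) := by
    obtain ⟨s, hs⟩ := hα i
    refine ⟨s, ?_⟩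
    rw [← algebraMap_eq, AlgHom.commutes] at hs
    rw [← hs, algebraMap_eq]
    ring
  choose s hs using hα'
  -- Modulo $\pi$ both gradients are multiples of $\nabla\pi$, so $\pi$ divides the Jacobian, a
  -- nonzero constant.
  rw [jac_eq, hs, hs] at hJ
  simp only [map_add, Derivation.leibniz, smul_eq_mul, pderiv_C, add_zero] at hJ
  apply hπ.not_isUnit
  refine isUnit_of_dvd_unit ?_ ((isUnit_iff_ne_zero.2 hc).map C)
  rw [← hJ]
  exact ⟨pderiv 0 (s 0) * (π * pderiv 1 (s 1) + s 1 * pderiv 1 π) +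
    s 0 * pderiv 0 π * pderiv 1 (s 1) - pderiv 1 (s 0) * (π * pderiv 0 (s 1) + s 1 * pderiv 0 π) -
    s 0 * pderiv 1 π * pderiv 0 (s 1), by ring⟩

end Keller

/-! ### Formanek's theorem and the fraction $y=u/v$ -/

section Fractions

open Polynomial

theorem isCoprime_pderiv_one {p q : PolyXY} {c : ℂ} (hc : c ≠ 0)
    (hJ : jac p q = MvPolynomial.C c) :
    IsCoprime (MvPolynomial.pderiv 1 p) (MvPolynomial.pderiv 1 q) := by
  refine ⟨-MvPolynomial.C c⁻¹ * MvPolynomial.pderiv 0 q,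
    MvPolynomial.C c⁻¹ * MvPolynomial.pderiv 0 p, ?_⟩
  have h : (MvPolynomial.C c⁻¹ * MvPolynomial.C c : PolyXY) = 1 := by
    rw [← map_mul, inv_mul_cancel₀ hc, map_one]
  rw [← h, ← hJ, jac_eq]
  ring

/-- Formanek: the field `ℂ(p, q, x)` contains `y`. -/
theorem X_one_mem_adjoin {p q : PolyXY} {c : ℂ} (hc : c ≠ 0)
    (hJ : jac p q = MvPolynomial.C c) :
    algebraMap PolyXY RatXY (MvPolynomial.X 1) ∈ IntermediateField.adjoin ℂ
      (algebraMap PolyXY RatXY '' {p, q, MvPolynomial.X 0}) := by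
  set L := IntermediateField.adjoin ℂ (algebraMap PolyXY RatXY '' {p, q, MvPolynomial.X 0})
  -- View $\mathbb{C}[x,y]$ as $\mathbb{C}[x][y]$, so that $\partial/\partial y$ becomes
  -- `derivative`.
  let e := Bivariate.equivMvPolynomial ℂ
  let ι : ℂ[X][X] →+* RatXY := (algebraMap PolyXY RatXY).comp (e : ℂ[X][X] →+* PolyXY)
  have hι : Function.Injective ι :=
    (IsFractionRing.injective PolyXY RatXY).comp e.injective
  have hιe (a : PolyXY) : ι (e.symm a) = algebraMap PolyXY RatXY a := by simp [ι]
  have hgen {a : PolyXY} (ha : a ∈ ({p, q, MvPolynomial.X 0} : Set PolyXY)) :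
      ι (e.symm a) ∈ (algebraMap L RatXY).range :=
    ⟨⟨_, IntermediateField.subset_adjoin ℂ _ ⟨a, ha, rfl⟩⟩, (hιe a).symm⟩
  have hder (a : PolyXY) : derivative (e.symm a) = e.symm (MvPolynomial.pderiv 1 a) := by
    apply e.injective
    rw [← Bivariate.pderiv_one_equivMvPolynomial]
    simp [e]
  have hX : e.symm (MvPolynomial.X 1) = X := Bivariate.equivMvPolynomial_symm_X_1
  have hR (r : ℂ[X]) : ι (C r) ∈ (algebraMap L RatXY).range := by
    obtain ⟨z, hz⟩ := hgen (a := MvPolynomial.X 0) (by simp)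
    have h₀ : e.symm (MvPolynomial.X 0) = C X := Bivariate.equivMvPolynomial_symm_X_0
    rw [h₀] at hz
    induction r using Polynomial.induction_on' with
    | add a b ha hb => rw [map_add, map_add]; exact add_mem ha hb
    | monomial n a =>
      rw [← C_mul_X_pow_eq_monomial, map_mul, map_mul, map_pow, map_pow, ← hz]
      refine (algebraMap L RatXY).range.mul_mem ⟨algebraMap ℂ L a, ?_⟩
        ((algebraMap L RatXY).range.pow_mem ⟨z, rfl⟩ n)
      have : (C (C a) : ℂ[X][X]) = algebraMap ℂ _ a := rfl
      rw [this]
      simp only [ι, RingHom.comp_apply, RingHom.coe_coe, AlgEquiv.commutes]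
      rfl
  have hcop : IsCoprime (derivative (e.symm p)) (derivative (e.symm q)) := by
    rw [hder, hder]
    exact (isCoprime_pderiv_one hc hJ).map (e.symm : PolyXY →+* ℂ[X][X])
  obtain ⟨z, hz⟩ := X_mem_range_of_isCoprime_derivative hι hR hcop
    (hgen (by simp)) (hgen (by simp))
  rw [← hιe, hX, ← hz]
  exact z.2

theorem exists_isFractionForY {p q : PolyXY} {c : ℂ} (hc : c ≠ 0)
    (hJ : jac p q = MvPolynomial.C c)
    (halg : Algebra.IsAlgebraic (Algebra.adjoin ℂ {p, q}) PolyXY) :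
    ∃ u v : PolyXY, IsFractionForY p q u v := by
  have hmap (S : Set PolyXY) : Algebra.adjoin ℂ (algebraMap PolyXY RatXY '' S) =
      (Algebra.adjoin ℂ S).map (IsScalarTower.toAlgHom ℂ PolyXY RatXY) :=
    (AlgHom.map_adjoin (IsScalarTower.toAlgHom ℂ PolyXY RatXY) S).symm
  obtain ⟨r, hr, s, hs, h⟩ := IntermediateField.mem_adjoin_iff_div.1 (X_one_mem_adjoin hc hJ)
  rw [hmap] at hr hs
  obtain ⟨a, ha, rfl⟩ := hr
  obtain ⟨b, hb, rfl⟩ := hs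
  simp only [AlgHom.coe_toRingHom, IsScalarTower.coe_toAlgHom'] at h
  have hy : algebraMap PolyXY RatXY (MvPolynomial.X 1) ≠ 0 := by simp
  have hab : algebraMap PolyXY RatXY a ≠ 0 ∧ algebraMap PolyXY RatXY b ≠ 0 :=
    div_ne_zero_iff.1 (h ▸ hy)
  have hb0 : b ≠ 0 := by rintro rfl; simp at hab
  -- Since $b$ is algebraic over $\mathbb{C}[p,q]$, some $t\in\mathbb{C}[p,q][b]$ has
  -- $bt\in\mathbb{C}[p,q]\setminus\{0\}$; expand $a/b$ by $t$.
  obtain ⟨t, ht, v, hv, hbt⟩ := (halg.isAlgebraic b).exists_nonzero_eq_adjoin_mul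
    (mem_nonZeroDivisors_of_ne_zero hb0)
  have hle : Algebra.adjoin ℂ {p, q} ≤ Algebra.adjoin ℂ {p, q, MvPolynomial.X 0} :=
    Algebra.adjoin_mono (by grind)
  have ht' : t ∈ Algebra.adjoin ℂ {p, q, MvPolynomial.X 0} := by
    refine Algebra.adjoin_induction ?_ ?_ (fun _ _ _ _ ↦ add_mem) (fun _ _ _ _ ↦ mul_mem) ht
    · rintro _ rfl
      exact hb
    · exact fun r ↦ hle r.2
  have hv0 : (v : PolyXY) ≠ 0 := by simpa using hv
  have hbt' : b * t = v := hbt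
  have ht0 : t ≠ 0 := by rintro rfl; simp at hbt'; exact hv0 hbt'.symm
  refine ⟨a * t, v, mul_mem ha ht', mul_ne_zero (fun h0 ↦ hab.1 (by simp [h0])) ht0, v.2, hv0, ?_⟩
  rw [h, ← hbt', map_mul, map_mul, mul_div_mul_right _ _ (by simpa using ht0)]

end Fractions

/-! ### The derivative of the equation of $x$ divides a power of $v$ -/

section Unramified

open Polynomial

variable {B : Subalgebra ℂ PolyXY} {v : B} {U : B[X]}

/-- After multiplication by a power of `v`, every polynomial is a polynomial in `x` over `B`,
and the derivation of `B[x]` over `B` corresponds to `∂/∂x + (∂y/∂x) ∂/∂y`. -/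
theorem exists_aeval_eq_pow_mul
    (hU : (v : PolyXY) * MvPolynomial.X 1 = aeval (MvPolynomial.X 0 : PolyXY) U) (a : PolyXY) :
    ∃ (N : ℕ) (H : B[X]), aeval (MvPolynomial.X 0 : PolyXY) H = (v : PolyXY) ^ N * a ∧
      (v : PolyXY) * aeval (MvPolynomial.X 0 : PolyXY) (derivative H) =
        (v : PolyXY) ^ N * (v * MvPolynomial.pderiv 0 a +
          aeval (MvPolynomial.X 0 : PolyXY) (derivative U) * MvPolynomial.pderiv 1 a) := by
  have hb (b : B) : algebraMap B PolyXY b = b := rfl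
  induction a using MvPolynomial.induction_on with
  | C a => exact ⟨0, C (algebraMap ℂ B a), by
      rw [aeval_C, ← IsScalarTower.algebraMap_apply, pow_zero, one_mul, MvPolynomial.algebraMap_eq],
      by simp⟩
  | add a b iha ihb =>
    obtain ⟨N, H, h₁, h₂⟩ := iha
    obtain ⟨M, K, k₁, k₂⟩ := ihb
    refine ⟨N + M, C (v ^ M) * H + C (v ^ N) * K, ?_, ?_⟩
    · simp only [map_add, map_mul, aeval_C, h₁, k₁, map_pow, hb]
      ring
    · rw [derivative_add, derivative_C_mul, derivative_C_mul]
      simp only [map_add, map_mul, aeval_C, map_pow, hb]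
      linear_combination (v : PolyXY) ^ M * h₂ + (v : PolyXY) ^ N * k₂
  | mul_X a j iha =>
    obtain ⟨N, H, h₁, h₂⟩ := iha
    fin_cases j
    · refine ⟨N, H * X, ?_, ?_⟩
      · simp [h₁, mul_assoc]
      · simp only [derivative_mul, derivative_X, map_add, map_mul, aeval_X, h₁,
          Derivation.leibniz, smul_eq_mul, Fin.zero_eta, mul_one,
          MvPolynomial.pderiv_X_self, MvPolynomial.pderiv_X_of_ne (R := ℂ) (zero_ne_one (α := Fin 2))]
        linear_combination MvPolynomial.X 0 * h₂
    · refine ⟨N + 1, H * U, ?_, ?_⟩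
      · simp only [map_mul, h₁, ← hU, Fin.mk_one]
        ring
      · simp only [derivative_mul, map_add, map_mul, h₁, ← hU,
          Derivation.leibniz, smul_eq_mul, Fin.mk_one,
          MvPolynomial.pderiv_X_self, MvPolynomial.pderiv_X_of_ne (R := ℂ) (one_ne_zero (α := Fin 2))]
        linear_combination (v * MvPolynomial.X 1) * h₂

/-- The extension `B[1/v] → ℂ[x, y][1/v]` is unramified: the derivative of the equation of `x`
divides a power of `v`. -/
theorem aeval_derivative_dvd_pow
    (hU : (v : PolyXY) * MvPolynomial.X 1 = aeval (MvPolynomial.X 0 : PolyXY) U)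
    {p q : B} {c : ℂ} (hc : c ≠ 0) (hJ : jac (p : PolyXY) q = MvPolynomial.C c) {g : B[X]}
    (hgx : aeval (MvPolynomial.X 0 : PolyXY) g = 0)
    (hg : ∀ H : B[X], aeval (MvPolynomial.X 0 : PolyXY) H = 0 → g ∣ H) :
    ∃ n, aeval (MvPolynomial.X 0 : PolyXY) (derivative g) ∣ (v : PolyXY) ^ n := by
  have hb (b : B) : algebraMap B PolyXY b = b := rfl
  have key (b : B) : ∃ N, aeval (MvPolynomial.X 0 : PolyXY) (derivative g) ∣
      (v : PolyXY) ^ N * (v * MvPolynomial.pderiv 0 (b : PolyXY) +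
        aeval (MvPolynomial.X 0 : PolyXY) (derivative U) * MvPolynomial.pderiv 1 (b : PolyXY)) := by
    obtain ⟨N, H, h₁, h₂⟩ := exists_aeval_eq_pow_mul hU b
    -- For $b\in B$, subtracting the constant $v^N b$ leaves a multiple $gK$, so $H'(x)=g'(x)K(x)$.
    obtain ⟨K, hK⟩ := hg (H - C (v ^ N * b)) (by simp [h₁, hb])
    have hH : derivative H = derivative (g * K) := by
      rw [← hK, derivative_sub, derivative_C, sub_zero]
    refine ⟨N, v * aeval (MvPolynomial.X 0 : PolyXY) K, ?_⟩
    rw [← h₂, hH, derivative_mul, map_add, map_mul, map_mul, hgx]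
    ring
  obtain ⟨N, s, hs⟩ := key p
  obtain ⟨M, t, ht⟩ := key q
  rw [jac_eq] at hJ
  have h1 : (MvPolynomial.C c⁻¹ * MvPolynomial.C c : PolyXY) = 1 := by
    rw [← map_mul, inv_mul_cancel₀ hc, map_one]
  -- Cramer's rule: $(vp_x+U'p_y)q_y-(vq_x+U'q_y)p_y=v\,\mathrm{Jac}(p,q)$, which eliminates
  -- $U'(x)$.
  refine ⟨N + M + 1, MvPolynomial.C c⁻¹ * ((v : PolyXY) ^ M * s * MvPolynomial.pderiv 1 (q : PolyXY) -
    (v : PolyXY) ^ N * t * MvPolynomial.pderiv 1 (p : PolyXY)), ?_⟩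
  linear_combination (MvPolynomial.C c⁻¹ * v ^ M * MvPolynomial.pderiv 1 (q : PolyXY)) * hs -
    (MvPolynomial.C c⁻¹ * v ^ N * MvPolynomial.pderiv 1 (p : PolyXY)) * ht -
    (v : PolyXY) ^ (N + M + 1) * (MvPolynomial.C c⁻¹ * hJ + h1)

end Unramified

/-! ### From the condition on units to bijectivity -/

/-- The ring contains $x$ and $y=u\cdot v^{-1}$. This is what makes polynomial divisors of powers of
$v$ invertible in it. -/
theorem mem_pqxInv {p q u v : PolyXY} (h : IsFractionForY p q u v) (a : PolyXY) :
    algebraMap PolyXY RatXY a ∈ pqxInv p q v := by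
  have hgen {z : RatXY} (hz : z ∈ ({algebraMap PolyXY RatXY p, algebraMap PolyXY RatXY q,
      algebraMap PolyXY RatXY (MvPolynomial.X 0), (algebraMap PolyXY RatXY v)⁻¹} : Set RatXY)) :
      z ∈ pqxInv p q v := Algebra.subset_adjoin hz
  have hle : Algebra.adjoin ℂ {p, q, MvPolynomial.X 0} ≤
      (pqxInv p q v).comap (IsScalarTower.toAlgHom ℂ PolyXY RatXY) := by
    rw [Algebra.adjoin_le_iff]
    rintro z (rfl | rfl | rfl) <;> exact hgen (by simp)
  have hX : (⊤ : Subalgebra ℂ PolyXY) ≤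
      (pqxInv p q v).comap (IsScalarTower.toAlgHom ℂ PolyXY RatXY) := by
    rw [← MvPolynomial.adjoin_range_X, Algebra.adjoin_le_iff]
    rintro _ ⟨i, rfl⟩
    fin_cases i
    · exact hgen (by simp)
    · change algebraMap PolyXY RatXY (MvPolynomial.X 1) ∈ pqxInv p q v
      rw [h.y_eq, div_eq_mul_inv]
      exact mul_mem (hle h.u_mem) (hgen (by simp))
  exact hX (Algebra.mem_top (x := a))

theorem exists_mul_eq_of_mem_fieldPQ {p q z : PolyXY}
    (hz : algebraMap PolyXY RatXY z ∈ fieldPQ p q) :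
    ∃ b₁ b₂ : Algebra.adjoin ℂ {p, q}, b₂ ≠ 0 ∧ (b₂ : PolyXY) * z = b₁ := by
  have hmap : Algebra.adjoin ℂ {algebraMap PolyXY RatXY p, algebraMap PolyXY RatXY q} =
      (Algebra.adjoin ℂ {p, q}).map (IsScalarTower.toAlgHom ℂ PolyXY RatXY) := by
    rw [AlgHom.map_adjoin, Set.image_pair]
    rfl
  obtain ⟨r, hr, s, hs, h⟩ := IntermediateField.mem_adjoin_iff_div.1 hz
  by_cases hs0 : s = 0
  · have hz0 : z = 0 := by simpa [hs0] using h
    exact ⟨0, 1, one_ne_zero, by simp [hz0]⟩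
  rw [hmap] at hr hs
  obtain ⟨a, ha, rfl⟩ := hr
  obtain ⟨b, hb, rfl⟩ := hs
  refine ⟨⟨a, ha⟩, ⟨b, hb⟩, fun h0 ↦ hs0 ?_, ?_⟩
  · have : b = 0 := congrArg Subtype.val h0
    simp [this]
  · apply IsFractionRing.injective PolyXY RatXY
    rw [eq_div_iff hs0] at h
    rw [map_mul, mul_comm]
    exact h

theorem exists_aeval_eq_of_mem_adjoin {p q x u : PolyXY} (hu : u ∈ Algebra.adjoin ℂ {p, q, x}) :
    ∃ U : Polynomial (Algebra.adjoin ℂ {p, q}), Polynomial.aeval x U = u := by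
  have hle : Algebra.adjoin ℂ {p, q, x} ≤
      (Polynomial.aeval (R := Algebra.adjoin ℂ {p, q}) x).range.restrictScalars ℂ := by
    rw [Algebra.adjoin_le_iff]
    have hC (z : PolyXY) (hz : z ∈ Algebra.adjoin ℂ {p, q}) :
        z ∈ (Polynomial.aeval (R := Algebra.adjoin ℂ {p, q}) x).range :=
      ⟨Polynomial.C ⟨z, hz⟩, Polynomial.aeval_C _ _⟩
    intro z hz
    rcases hz with hz | hz | hz
    · exact hC z (Algebra.subset_adjoin (by simp [hz]))
    · exact hC z (Algebra.subset_adjoin (by simp_all))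
    · exact ⟨Polynomial.X, (Polynomial.aeval_X x).trans hz.symm⟩
  exact hle hu

theorem bijective_of_units_mem {f : PolyXY →ₐ[ℂ] PolyXY} {p q : PolyXY}
    (hp : p = f (MvPolynomial.X 0)) (hq : q = f (MvPolynomial.X 1)) {c : ℂ} (hc : c ≠ 0)
    (hJ : jac p q = MvPolynomial.C c) {u v : PolyXY} (h : IsFractionForY p q u v)
    (hun : (Set.range fun a : (pqxInv p q v)ˣ => ((a : pqxInv p q v) : RatXY)) ⊆
        (fieldPQ p q : Set RatXY) \ {0}) : Function.Bijective f := by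
  have hf : Function.Injective f := injective_of_jac hc (hp ▸ hq ▸ hJ)
  have hrange : f.range = Algebra.adjoin ℂ {p, q} := hp ▸ hq ▸ range_eq_adjoin
  have halg : Algebra.IsAlgebraic (Algebra.adjoin ℂ {p, q}) PolyXY :=
    hp ▸ hq ▸ isAlgebraic_of_injective hf
  let B := Algebra.adjoin ℂ {p, q}
  have hv0 : algebraMap PolyXY RatXY v ≠ 0 := by simpa using h.v_ne_zero
  have hyv : v * MvPolynomial.X 1 = u := by
    apply IsFractionRing.injective PolyXY RatXY
    rw [map_mul, h.y_eq, mul_div_cancel₀ _ hv0]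
  have : UniqueFactorizationMonoid B :=
    MulEquiv.uniqueFactorizationMonoid (α := PolyXY)
      ((AlgEquiv.ofInjective f hf).trans (Subalgebra.equivOfEq _ _ hrange)).toMulEquiv
      inferInstance
  let ξ : PolyXY := MvPolynomial.X 0
  obtain ⟨U, hU⟩ := exists_aeval_eq_of_mem_adjoin h.u_mem
  obtain ⟨g, hg0, hgx, hg⟩ := exists_generator_of_isAlgebraic (halg.isAlgebraic ξ)
  let v' : B := ⟨v, h.v_mem⟩
  let p' : B := ⟨p, Algebra.subset_adjoin (by simp)⟩
  let q' : B := ⟨q, Algebra.subset_adjoin (by simp)⟩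
  obtain ⟨n, w, hw⟩ := aeval_derivative_dvd_pow (v := v') (U := U) (hyv.trans hU.symm)
    (p := p') (q := q') hc hJ hgx hg
  set d : PolyXY := Polynomial.aeval ξ (Polynomial.derivative g) with hd
  have hmul : algebraMap PolyXY RatXY d *
      (algebraMap PolyXY RatXY w * (algebraMap PolyXY RatXY v)⁻¹ ^ n) = 1 := by
    rw [← mul_assoc, ← map_mul, ← hw, map_pow, ← mul_pow, mul_inv_cancel₀ hv0, one_pow]
  have hvinv : (algebraMap PolyXY RatXY v)⁻¹ ∈ pqxInv p q v :=
    Algebra.subset_adjoin (by simp)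
  -- The only use of the hypothesis on units: $g'(x)$ has inverse $w v^{-n}$ in the localized ring.
  have hdmem : algebraMap PolyXY RatXY d ∈ fieldPQ p q := by
    refine (hun ⟨Units.mkOfMulEqOne ⟨_, mem_pqxInv h d⟩
      ⟨_, mul_mem (mem_pqxInv h w) (pow_mem hvinv n)⟩ (Subtype.ext hmul), rfl⟩).1
  obtain ⟨b₁, b₂, hb₂, hb⟩ := exists_mul_eq_of_mem_fieldPQ hdmem
  obtain ⟨a, b, hb0, hab⟩ := exists_mul_eq_of_derivative_mem hg0 hgx hg hb₂ hb
  have hmem {a b : B} {z : PolyXY} (hb : b ≠ 0) (hz : (b : PolyXY) * z = a) : z ∈ f.range := by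
    obtain ⟨a', ha'⟩ : (a : PolyXY) ∈ f.range := hrange ▸ a.2
    obtain ⟨b', hb'⟩ : (b : PolyXY) ∈ f.range := hrange ▸ b.2
    refine mem_range_of_mul_eq (a := a') (b := b') hc (hp ▸ hq ▸ hJ) ?_ ?_
    · rintro rfl
      exact hb (Subtype.ext (by simpa using hb'.symm))
    · exact (congrArg (· * z) hb').trans (hz.trans ha'.symm)
  have hx : ξ ∈ f.range := hmem hb0 hab
  -- Once $x\in B$, the numerator $u$ lies in $B$, so $y=u/v$ is a fraction over $B$ and Keller's
  -- case applies again.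
  have hu : u ∈ B := by
    refine (Algebra.adjoin_le ?_ : Algebra.adjoin ℂ {p, q, MvPolynomial.X 0} ≤ B) h.u_mem
    rintro z (rfl | rfl | rfl)
    · exact p'.2
    · exact q'.2
    · exact hrange.le hx
  have hy : (MvPolynomial.X 1 : PolyXY) ∈ f.range :=
    hmem (a := ⟨u, hu⟩) (b := v') (fun h0 ↦ h.v_ne_zero (congrArg Subtype.val h0)) hyv
  refine ⟨hf, ?_⟩
  rw [← AlgHom.range_eq_top, eq_top_iff, ← MvPolynomial.adjoin_range_X, Algebra.adjoin_le_iff]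
  rintro _ ⟨i, rfl⟩
  fin_cases i
  · exact hx
  · exact hy

theorem theorem3p1 (f : PolyXY →ₐ[ℂ] PolyXY) (p q : PolyXY)
    (hp : p = f (MvPolynomial.X 0)) (hq : q = f (MvPolynomial.X 1))
    (hJac : ∃ c : ℂ, c ≠ 0 ∧ jac p q = MvPolynomial.C c) :
    (∃ u v : PolyXY, IsFractionForY p q u v) ∧
    ∀ u v : PolyXY, IsFractionForY p q u v →
      (Set.range fun a : (pqxInv p q v)ˣ => ((a : pqxInv p q v) : RatXY)) ⊆
        (fieldPQ p q : Set RatXY) \ {0} →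
      ∃ e : PolyXY ≃ₐ[ℂ] PolyXY, (e : PolyXY →ₐ[ℂ] PolyXY) = f := by
  obtain ⟨c, hc, hJ⟩ := hJac
  constructor
  · refine exists_isFractionForY hc hJ ?_
    subst hp hq
    exact isAlgebraic_of_injective (injective_of_jac hc hJ)
  · intro u v h hun
    exact ⟨AlgEquiv.ofBijective f (bijective_of_units_mem hp hq hc hJ h hun), by ext; rfl⟩
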